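/- All logarithms are to base $2$. For a probability distribution $P$ on a finite set put $H(P)=-\sum_x P(x)\log P(x)$ and $V(P)=\sum_x P(x)(-\log P(x)-H(P))^2$ (terms with $P(x)=0$ count as $0$); $P^n$ is its $n$-fold i.i.d. power, and $F(Q,Q')=\sum_y\sqrt{Q(y)Q'(y)}$. Write $P\prec P'$ ($P$ is majorized by $P'$; the two finite sets may differ) if for every $k$ the sum of the $k$ largest values of $P$ is at most that of $P'$. For $N\in\mathbb R$ let $B_N$ be a set with $\lfloor 2^N\rfloor$ elements. For $P$ on $\mathcal X$ and $Q$ on $\mathcal Y$ let $$F^{\mathcal D}(P\to Q|N)=\sup\{F(W'\circ W(P),Q)\mid W:\mathcal X\to B_N,\ W':B_N\to\mathcal Y\},$$ $$F^{\mathcal M}(P\to Q|N)=\sup\{F(P'',Q)\mid P\prec P'\prec P'',\ P'\text{ a distribution on }B_N,\ P''\text{ a distribution on }\mathcal Y\},$$ where $W(P)$ is the image distribution (and $\sup\emptyset=0$). For $i\in\{\mathcal D,\mathcal M\}$ and $s_2,t_2\in\mathbb R$ define the optimal second-order fidelity at the admissible first-order rate pair $(H(P),H(P)/H(Q))$ by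 $$F^i_{P,Q,s_2}(t_2)=\liminf_{n\to\infty}F^i\bigl(P^n\to Q^{T_n}\bigm|S_n\bigr),\qquad S_n=H(P)n+s_2\sqrt n,\quad T_n=\tfrac{H(P)}{H(Q)}n+t_2\sqrt n ,$$ where the number of copies $T_n$ is rounded down to a natural number (to $0$ if $T_n<0$). Let $\Phi$ be the standard normal distribution function and $N_{\mu,v}$ the density of the normal distribution with mean $\mu$ and variance $v$. For $v>0$ and $s,\mu\in\mathbb R$ let $$Z_{v,s}(\mu)=1-\sup_{A\in\mathcal A_s}\Bigl(\int_{\mathbb R}\sqrt{A'(x)N_{\mu,v}(x)}\,dx\Bigr)^2,$$ where $\mathcal A_s$ is the set of continuously differentiable increasing functions $A:\mathbb R\to[0,1]$ with $A(s)=1$ and $\Phi\le A\le 1$. Put $C_{P,Q}=\frac{H(P)}{V(P)}\bigl(\frac{H(Q)}{V(Q)}\bigr)^{-1}$ and $D_{P,Q}=H(Q)/\sqrt{V(P)}$. **Theorem.** Let $l\ge 2$, let $U_l$ be the uniform distribution on a set of $l$ elements, and let $Q$ be a probability distribution on a finite set that is not uniform on its support. Let $s_2,t_2\in\mathbb R$.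 Then, for $i=\mathcal D$ and for $i=\mathcal M$, $$F^{i}_{U_l,Q,s_2}(t_2)=\sqrt{\Phi\left(\sqrt{\frac{H(Q)}{V(Q)\log l}}\,\bigl(\min\{s_2,0\}-H(Q)t_2\bigr)\right)},$$ and the lower limit has the same value for all real sequences $S_n=(\log l)n+s_2\sqrt n+o(\sqrt n)$ and $T_n=\frac{\log l}{H(Q)}n+t_2\sqrt n+o(\sqrt n)$. Moreover $$F^{i}_{U_l,Q,s_2}(t_2)=\lim_{P\to U_l}\sqrt{1-Z_{C_{P,Q},\,s_2/\sqrt{V(P)}}\bigl(t_2D_{P,Q}\bigr)},$$ the limit being over probability distributions $P\ne U_l$ on the same $l$-element set. -/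

import Mathlib

open Filter Topology Asymptotics MeasureTheory ProbabilityTheory

noncomputable section

/-- Probability distributions on a finite set. -/
abbrev ProbDist (X : Type*) [Fintype X] : Type _ := stdSimplex ℝ X

/-- The `n`-fold independent and identically distributed power `P ^ n`, on `X ^ n`. -/
def ProbDist.iid {X : Type*} [Fintype X] (P : ProbDist X) (n : ℕ) : ProbDist (Fin n → X) :=
  ⟨fun x => ∏ i, P (x i), fun _ => Finset.prod_nonneg fun i _ => P.2.1 _, by
    classical
    have h := Fintype.sum_pow (fun a => P a) n
    rw [← h]
    have h1 : ∑ a, P a = 1 := P.2.2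
    rw [h1, one_pow]⟩

/-- The uniform distribution `U_l` on a set `X` of `l` elements. -/
abbrev uniformDist (X : Type*) [Fintype X] [Nonempty X] : ProbDist X :=
  stdSimplex.barycenter

/-- The Shannon entropy, in bits. -/
def shannonEntropy {X : Type*} [Fintype X] (P : ProbDist X) : ℝ :=
  ∑ x, P x * (-Real.logb 2 (P x))

/-- The variance of the self-information `-log P(x)`, in squared bits. -/
def infoVariance {X : Type*} [Fintype X] (P : ProbDist X) : ℝ :=
  ∑ x, P x * (-Real.logb 2 (P x) - shannonEntropy P) ^ 2

/-- `P` is the uniform distribution on a (nonempty) subset of its alphabet, its support. -/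
def IsUniformDist {X : Type*} [Fintype X] (P : ProbDist X) : Prop :=
  ∃ c : ℝ, ∀ x, P x = 0 ∨ P x = c

/-- The fidelity (Bhattacharyya coefficient) of two distributions on the same set. -/
def fidelity {Y : Type*} [Fintype Y] (Q Q' : ProbDist Y) : ℝ :=
  ∑ y, √(Q y) * √(Q' y)

/-- The sum of the `k` largest probabilities of `P`. -/
def sumLargest {X : Type*} [Fintype X] (P : ProbDist X) (k : ℕ) : ℝ :=
  (Finset.univ.filter fun s : Finset X => s.card ≤ k).sup' ⟨∅, by simp⟩
    fun s => ∑ x ∈ s, P x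

/-- `P ≺ Q`: `P` is majorized by `Q` (the two alphabets may differ). -/
def Majorized {X Y : Type*} [Fintype X] [Fintype Y] (P : ProbDist X) (Q : ProbDist Y) : Prop :=
  ∀ k : ℕ, sumLargest P k ≤ sumLargest Q k

/-- The two kinds of conversion. -/
inductive Conversion
  | deterministic
  | majorization

/-- The maximal fidelity `F^i(P → Q | N)` of a conversion of kind `i` from `P` to `Q` that is
routed through a storage of size `N` bits, that is, through a set of cardinality `2 ^ N`
(rounded down when `2 ^ N` is not an integer). -/
def maxFidelity {X Y : Type*} [Fintype X] [Fintype Y] (i : Conversion)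
    (P : ProbDist X) (Q : ProbDist Y) (N : ℝ) : ℝ :=
  match i with
  | .deterministic =>
      sSup {f : ℝ | ∃ (W : X → Fin ⌊(2 : ℝ) ^ N⌋₊) (W' : Fin ⌊(2 : ℝ) ^ N⌋₊ → Y),
        f = fidelity (stdSimplex.map W' (stdSimplex.map W P)) Q}
  | .majorization =>
      sSup {f : ℝ | ∃ (P' : ProbDist (Fin ⌊(2 : ℝ) ^ N⌋₊)) (P'' : ProbDist Y),
        Majorized P P' ∧ Majorized P' P'' ∧ f = fidelity P'' Q}

/-- `liminf_n F^i(P ^ n → Q ^ (T n) | S n)`: storage of `S n` bits, and `T n` copies of the target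
(rounded down when `T n` is not an integer). -/
def liminfFidelity {X Y : Type*} [Fintype X] [Fintype Y] (i : Conversion)
    (P : ProbDist X) (Q : ProbDist Y) (S T : ℕ → ℝ) : ℝ :=
  liminf (fun n : ℕ => maxFidelity i (P.iid n) (Q.iid ⌊T n⌋₊) (S n)) atTop

/-- The second-order fidelity `F^i_{P,Q,s₁,t₁,s₂}(t₂)`. -/
def secondOrderFidelity {X Y : Type*} [Fintype X] [Fintype Y] (i : Conversion)
    (P : ProbDist X) (Q : ProbDist Y) (s₁ t₁ s₂ t₂ : ℝ) : ℝ :=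
  liminfFidelity i P Q (fun n => s₁ * n + s₂ * √n) (fun n => t₁ * n + t₂ * √n)

/-- The second-order fidelity `F^i_{P,Q,s₂}(t₂)` at the admissible first-order rate pair
`(H(P), H(P) / H(Q))`. -/
def admissibleFidelity {X Y : Type*} [Fintype X] [Fintype Y] (i : Conversion)
    (P : ProbDist X) (Q : ProbDist Y) (s₂ t₂ : ℝ) : ℝ :=
  secondOrderFidelity i P Q (shannonEntropy P) (shannonEntropy P / shannonEntropy Q) s₂ t₂

/-- The standard normal cumulative distribution function `Φ`. -/
def stdNormalCDF (x : ℝ) : ℝ := cdf (gaussianReal 0 1) x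

/-- The set `𝒜_s` of continuously differentiable increasing functions `A` with `A(s) = 1` and
`Φ ≤ A ≤ 1`. -/
def rayleighClass (s : ℝ) : Set (ℝ → ℝ) :=
  {A | ContDiff ℝ 1 A ∧ Monotone A ∧ A s = 1 ∧ ∀ x, stdNormalCDF x ≤ A x ∧ A x ≤ 1}

/-- The continuous fidelity `∫ √(p(x) q(x)) dx`. -/
def contFidelity (p q : ℝ → ℝ) : ℝ := ∫ x, √(p x * q x)

/-- The generalized Rayleigh-normal distribution function `Z_{v,s}(μ)`, for `v > 0`. -/
def rayleighNormal (v s μ : ℝ) : ℝ :=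
  1 - sSup {f : ℝ | ∃ A ∈ rayleighClass s,
    f = contFidelity (deriv A) (gaussianPDFReal μ v.toNNReal) ^ 2}

/-- `C_{P,Q} = (H(P) / V(P)) (H(Q) / V(Q))⁻¹`. -/
def coeffC {X Y : Type*} [Fintype X] [Fintype Y] (P : ProbDist X) (Q : ProbDist Y) : ℝ :=
  shannonEntropy P / infoVariance P * (shannonEntropy Q / infoVariance Q)⁻¹

/-- `D_{P,Q} = H(Q) / √V(P)`. -/
def coeffD {X Y : Type*} [Fintype X] [Fintype Y] (P : ProbDist X) (Q : ProbDist Y) : ℝ :=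
  shannonEntropy Q / √(infoVariance P)

end

/-! The source is already uniform on `l ^ n` points, so only two sizes matter: that of the source
alphabet and that of the storage. Put `M = min (l ^ n) (2 ^ S n)`. Any admissible output lives on at
most `M` points, so by Cauchy-Schwarz its fidelity with `Q ^ m` is at most the square root of the `Q
^ m`-mass of those points. Points of probability below `2 ^ (-b)` contribute at most `M * 2 ^ (-b)`,
and the rest at most the mass of self-information `≤ b` (`maxFidelity_le`, for the larger,
majorization, fidelity). Conversely there are at most `2 ^ b` points of self-information `≤ b`, and
a deterministic map produces the distribution `Q ^ m` conditioned on them up to rounding, at a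
relative loss of `2 ^ b / l ^ n` (`le_maxFidelity_uniform`). With `b = log M ± √√n` both errors
vanish while `b` moves by `o(√n)` only, and the central limit theorem for the self-information
evaluates the mass. This gives a genuine limit, hence the lower limit.

As `P → U_l`, the variance `V(P)` tends to `0`, and the parameters of `Z` blow up like `s * w ^ 2`,
`m * w ^ 2` and `c * w ^ 4` with `w = V(P) ^ (-1/4)`. On the scale `w ^ 2` the function `Φ` becomes
a unit step at `0`. The constraints `Φ ≤ A` and `A(s) = 1` then say only that `A` has its mass to
the left of `min s 0`, and the best squared fidelity is the normal mass of that half-line: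
`contFidelity_le` bounds it above, `mul_stdNormalCDF_le_one_sub_rayleighNormal` below. -/

noncomputable section

/-! ### Fidelity bounds at a fixed blocklength -/

/-- The probability of the outcomes whose self-information is at most `b` bits. -/
def typicalMass {Y : Type*} [Fintype Y] (Q : ProbDist Y) (b : ℝ) : ℝ :=
  ∑ y with (2 : ℝ) ^ (-b) ≤ Q y, Q y

section FixedLength

variable {X Y : Type*} [Fintype X] [Fintype Y]

lemma stdSimplex_map_apply [DecidableEq Y] (f : X → Y) (P : ProbDist X) (y : Y) :
    stdSimplex.map f P y = ∑ x with f x = y, P x := by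
  simp [FunOnFinite.linearMap_apply_apply, Finset.sum_filter]

lemma sum_le_sumLargest (P : ProbDist X) {k : ℕ} {s : Finset X} (hs : s.card ≤ k) :
    ∑ x ∈ s, P x ≤ sumLargest P k :=
  Finset.le_sup' (fun s : Finset X => ∑ x ∈ s, P x) (by simpa using hs)

lemma exists_sum_eq_sumLargest (P : ProbDist X) (k : ℕ) :
    ∃ s : Finset X, s.card ≤ k ∧ sumLargest P k = ∑ x ∈ s, P x := by
  obtain ⟨s, hs, h⟩ := Finset.exists_mem_eq_sup' (s := Finset.univ.filter
    fun s : Finset X => s.card ≤ k) ⟨∅, by simp⟩ (fun s => ∑ x ∈ s, P x)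
  exact ⟨s, by simpa using hs, h⟩

lemma one_le_sumLargest (P : ProbDist X) {k : ℕ} (hk : Fintype.card X ≤ k) :
    1 ≤ sumLargest P k := by
  have h : ∑ x, P x = 1 := P.2.2
  rw [← h]
  exact sum_le_sumLargest P hk

/-- The image of a set of `k` points has at most `k` points and carries at least as much mass. Hence
every deterministic conversion is a majorization conversion. -/
lemma majorized_map (f : X → Y) (P : ProbDist X) : Majorized P (stdSimplex.map f P) := by
  classical
  intro k
  obtain ⟨s, hs, h⟩ := exists_sum_eq_sumLargest P k
  rw [h]
  refine le_trans ?_ (sum_le_sumLargest _ (Finset.card_image_le (s := s) (f := f) |>.trans hs))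
  simp_rw [stdSimplex_map_apply]
  rw [← Finset.sum_fiberwise_of_maps_to (t := s.image f) (g := f)
    fun x hx => Finset.mem_image_of_mem f hx]
  refine Finset.sum_le_sum fun y _ => ?_
  exact Finset.sum_le_sum_of_subset_of_nonneg
    (Finset.filter_subset_filter _ (Finset.subset_univ s)) fun x _ _ => P.2.1 x

lemma fidelity_nonneg (Q Q' : ProbDist Y) : 0 ≤ fidelity Q Q' :=
  Finset.sum_nonneg fun _ _ => by positivity

/-- A distribution carried by the set `s` has fidelity at most `√(Q(s))` with `Q`. -/
lemma fidelity_le_sqrt_sum {P Q : ProbDist Y} {s : Finset Y} (hs : 1 ≤ ∑ y ∈ s, P y) :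
    fidelity P Q ≤ √(∑ y ∈ s, Q y) := by
  classical
  have hP : ∑ y, P y = 1 := P.2.2
  have hs1 : ∑ y ∈ s, P y ≤ 1 := hP ▸
    Finset.sum_le_sum_of_subset_of_nonneg (Finset.subset_univ s) fun y _ _ => P.2.1 y
  have hcompl : ∑ y ∈ sᶜ, P y = 0 := by
    have := Finset.sum_add_sum_compl s P
    linarith
  have hzero := (Finset.sum_eq_zero_iff_of_nonneg fun y _ => P.2.1 y).1 hcompl
  have hF : fidelity P Q = ∑ y ∈ s, √(P y) * √(Q y) := by
    unfold fidelity
    refine (Finset.sum_subset (Finset.subset_univ s) fun y _ hy => ?_).symm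
    have h0 : P y = 0 := hzero y (by simpa using hy)
    simp [h0]
  rw [hF]
  refine (Real.sum_sqrt_mul_sqrt_le s (fun y => P.2.1 y) (fun y => Q.2.1 y)).trans ?_
  refine mul_le_of_le_one_left (Real.sqrt_nonneg _) ?_
  exact Real.sqrt_le_one.2 hs1

lemma fidelity_le_one (P Q : ProbDist Y) : fidelity P Q ≤ 1 := by
  have hP : ∑ y, P y = 1 := P.2.2
  have hQ : ∑ y, Q y = 1 := Q.2.2
  simpa [hQ] using fidelity_le_sqrt_sum (P := P) (Q := Q) (s := Finset.univ) hP.ge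

lemma bddAbove_majorization (P : ProbDist X) (Q : ProbDist Y) (N : ℝ) :
    BddAbove {f : ℝ | ∃ (P' : ProbDist (Fin ⌊(2 : ℝ) ^ N⌋₊)) (P'' : ProbDist Y),
        Majorized P P' ∧ Majorized P' P'' ∧ f = fidelity P'' Q} :=
  ⟨1, by rintro _ ⟨_, P'', _, _, rfl⟩; exact fidelity_le_one P'' Q⟩

lemma maxFidelity_deterministic_le_majorization (P : ProbDist X) (Q : ProbDist Y) (N : ℝ) :
    maxFidelity .deterministic P Q N ≤ maxFidelity .majorization P Q N := by
  refine Real.sSup_le ?_ (Real.sSup_nonneg ?_)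
  · rintro _ ⟨W, W', rfl⟩
    exact le_csSup (bddAbove_majorization P Q N)
      ⟨_, _, majorized_map W P, majorized_map W' _, rfl⟩
  · rintro _ ⟨_, P'', _, _, rfl⟩
    exact fidelity_nonneg P'' Q

lemma sum_le_mul_add_typicalMass (Q : ProbDist Y) (b : ℝ) (s : Finset Y) :
    ∑ y ∈ s, Q y ≤ s.card * (2 : ℝ) ^ (-b) + typicalMass Q b := by
  classical
  rw [← Finset.sum_filter_add_sum_filter_not s (fun y => (2 : ℝ) ^ (-b) ≤ Q y), add_comm]
  refine add_le_add ?_ ?_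
  · refine (Finset.sum_le_card_nsmul _ _ ((2 : ℝ) ^ (-b)) fun y hy => ?_).trans ?_
    · exact (not_le.1 (Finset.mem_filter.1 hy).2).le
    · rw [nsmul_eq_mul]
      gcongr
      exact Finset.filter_subset _ _
  · exact Finset.sum_le_sum_of_subset_of_nonneg
      (Finset.filter_subset_filter _ (Finset.subset_univ s)) fun y _ _ => Q.2.1 y

lemma typicalMass_nonneg (Q : ProbDist Y) (b : ℝ) : 0 ≤ typicalMass Q b :=
  Finset.sum_nonneg fun y _ => Q.2.1 y

lemma typicalMass_le_one (Q : ProbDist Y) (b : ℝ) : typicalMass Q b ≤ 1 := by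
  have hQ : ∑ y, Q y = 1 := Q.2.2
  rw [← hQ]
  exact Finset.sum_le_sum_of_subset_of_nonneg (Finset.subset_univ _) fun y _ _ => Q.2.1 y

/-- Converse bound. -/
lemma maxFidelity_le (i : Conversion) (P : ProbDist X) (Q : ProbDist Y) (N b : ℝ) :
    maxFidelity i P Q N ≤
      √(min (Fintype.card X : ℝ) (2 ^ N) * (2 : ℝ) ^ (-b) + typicalMass Q b) := by
  suffices h : maxFidelity .majorization P Q N ≤
      √(min (Fintype.card X : ℝ) (2 ^ N) * (2 : ℝ) ^ (-b) + typicalMass Q b) by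
    cases i
    · exact (maxFidelity_deterministic_le_majorization P Q N).trans h
    · exact h
  refine Real.sSup_le ?_ (Real.sqrt_nonneg _)
  rintro _ ⟨P', P'', h1, h2, rfl⟩
  set k := min (Fintype.card X) ⌊(2 : ℝ) ^ N⌋₊ with hk
  -- Whichever size attains the minimum, `P` or `P'` puts all its mass on `k` points, and
  -- majorization passes this on to `P''`.
  have hone : 1 ≤ sumLargest P'' k := by
    rcases min_choice (Fintype.card X) ⌊(2 : ℝ) ^ N⌋₊ with h | h
    · exact ((one_le_sumLargest P (by rw [hk, h])).trans (h1 k)).trans (h2 k)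
    · exact (one_le_sumLargest P' (by rw [hk, h, Fintype.card_fin])).trans (h2 k)
  obtain ⟨s, hs, hsum⟩ := exists_sum_eq_sumLargest P'' k
  refine (fidelity_le_sqrt_sum (hsum ▸ hone)).trans (Real.sqrt_le_sqrt ?_)
  refine (sum_le_mul_add_typicalMass Q b s).trans ?_
  gcongr
  refine le_min ?_ ?_
  · exact_mod_cast hs.trans (min_le_left _ _)
  · exact (Nat.cast_le.2 (hs.trans (min_le_right _ _))).trans (Nat.floor_le (by positivity))

/-- Fibres of prescribed sizes: if the sizes add up to at most `card X`, some map `X → S` has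
fibres at least as large. -/
lemma exists_fiber_card_ge {S : Type*} [Fintype S] [Nonempty S] [DecidableEq S] (c : S → ℕ)
    (hc : ∑ y, c y ≤ Fintype.card X) :
    ∃ f : X → S, ∀ y, c y ≤ (Finset.univ.filter fun x => f x = y).card := by
  classical
  have hcard : Fintype.card (Σ y, Fin (c y)) ≤ Fintype.card X := by simpa using hc
  obtain ⟨e⟩ := Function.Embedding.nonempty_of_card_le hcard
  refine ⟨Function.extend e Sigma.fst fun _ => Classical.arbitrary S, fun y => ?_⟩
  calc c y = (Finset.univ.image fun j : Fin (c y) => e ⟨y, j⟩).card := by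
        rw [Finset.card_image_of_injective, Finset.card_fin]
        intro j j' h
        simpa using e.injective h
    _ ≤ _ := by
        refine Finset.card_le_card fun x hx => ?_
        obtain ⟨j, -, rfl⟩ := Finset.mem_image.1 hx
        simp [e.injective.extend_apply]

/-- Achievability bound. -/
lemma le_maxFidelity_uniform [Nonempty X] (Q : ProbDist Y) {N b : ℝ} (hb : b ≤ N) :
    √(1 - (2 : ℝ) ^ b / Fintype.card X) * √(typicalMass Q b) ≤
      maxFidelity .deterministic (uniformDist X) Q N := by
  classical
  -- With zero mass there is nothing to condition on, and the storage may even be empty; the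
  -- supremum is still nonnegative.
  rcases (typicalMass_nonneg Q b).eq_or_lt with hQ | hQ
  · rw [← hQ, Real.sqrt_zero, mul_zero]
    exact Real.sSup_nonneg (by rintro _ ⟨_, _, rfl⟩; exact fidelity_nonneg _ Q)
  set τ := typicalMass Q b with hτ
  set s : Finset Y := Finset.univ.filter fun y => (2 : ℝ) ^ (-b) ≤ Q y with hs
  have hτs : τ = ∑ y ∈ s, Q y := rfl
  have hτ1 : τ ≤ 1 := typicalMass_le_one Q b
  have hL : (0 : ℝ) < Fintype.card X := by exact_mod_cast Fintype.card_pos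
  set L : ℝ := ((Fintype.card X : ℕ) : ℝ) with hLdef
  have hsne : s.Nonempty := by
    by_contra h
    rw [Finset.not_nonempty_iff_eq_empty] at h
    rw [hτs, h, Finset.sum_empty] at hQ
    exact lt_irrefl _ hQ
  have hne : Nonempty s := hsne.to_subtype
  have hpow : (0 : ℝ) < 2 ^ b := by positivity
  have hscard : (s.card : ℝ) ≤ 2 ^ b := by
    have h1 : (s.card : ℝ) * 2 ^ (-b) ≤ 1 := by
      refine le_trans ?_ hτ1
      rw [hτs, ← nsmul_eq_mul]
      exact Finset.card_nsmul_le_sum _ _ _ fun y hy => (Finset.mem_filter.1 hy).2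
    rw [Real.rpow_neg (by norm_num), ← div_eq_mul_inv, div_le_one hpow] at h1
    exact h1
  have hsM : s.card ≤ ⌊(2 : ℝ) ^ N⌋₊ :=
    Nat.le_floor (hscard.trans (Real.rpow_le_rpow_of_exponent_le (by norm_num) hb))
  obtain ⟨e⟩ : Nonempty (s ↪ Fin ⌊(2 : ℝ) ^ N⌋₊) :=
    Function.Embedding.nonempty_of_card_le (by simpa using hsM)
  -- The fibre sizes are `L` times the conditional distribution `Q / τ` on `s`, rounded down.
  have hcsum : ∑ y : s, ⌊L * (Q y / τ)⌋₊ ≤ Fintype.card X := by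
    have h : ∑ y : s, L * (Q y / τ) = L := by
      rw [← Finset.mul_sum, ← Finset.sum_div, Finset.sum_coe_sort s (fun y => Q y), ← hτs,
        div_self hQ.ne', mul_one]
    have h2 : ((∑ y : s, ⌊L * (Q y / τ)⌋₊ : ℕ) : ℝ) ≤ L := by
      rw [Nat.cast_sum]
      refine le_trans (Finset.sum_le_sum fun y _ => ?_) h.le
      exact Nat.floor_le (mul_nonneg hL.le (div_nonneg (Q.2.1 y) hQ.le))
    exact (Nat.cast_le (α := ℝ)).1 h2
  obtain ⟨f, hf⟩ := exists_fiber_card_ge (X := X) (S := s) _ hcsum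
  have hbdd : BddAbove {r : ℝ | ∃ (W : X → Fin ⌊(2 : ℝ) ^ N⌋₊) (W' : Fin ⌊(2 : ℝ) ^ N⌋₊ → Y),
      r = fidelity (stdSimplex.map W' (stdSimplex.map W (uniformDist X))) Q} :=
    ⟨1, by rintro _ ⟨_, _, rfl⟩; exact fidelity_le_one _ Q⟩
  refine le_trans ?_ (le_csSup hbdd ⟨e ∘ f,
    fun j => (Function.extend e id (fun _ => Classical.arbitrary s) j : s), rfl⟩)
  rw [stdSimplex.map_comp_apply]
  have hcomp : (fun j => ((Function.extend e id (fun _ => Classical.arbitrary s) j : s) : Y)) ∘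
      (e ∘ f) = fun x => (f x : Y) := by
    funext x
    simp [e.injective.extend_apply]
  rw [hcomp]
  have hlow : ∀ y ∈ s, (1 - 2 ^ b / L) * (Q y / τ) ≤
      stdSimplex.map (fun x => (f x : Y)) (uniformDist X) y := by
    intro y hy
    have hQy : (2 : ℝ) ^ (-b) ≤ Q y := (Finset.mem_filter.1 hy).2
    have hmap : stdSimplex.map (fun x => (f x : Y)) (uniformDist X) y =
        (Finset.univ.filter fun x => f x = ⟨y, hy⟩).card * L⁻¹ := by
      rw [stdSimplex_map_apply]
      have : ∀ x, (uniformDist X) x = L⁻¹ := fun x => stdSimplex.barycenter_apply x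
      simp_rw [this, Finset.sum_const, nsmul_eq_mul]
      congr 3
      ext x
      simp [Subtype.ext_iff]
    rw [hmap, ← div_eq_mul_inv, le_div_iff₀ hL]
    have h1 : L * (Q y / τ) - 1 ≤ (⌊L * (Q y / τ)⌋₊ : ℝ) := (Nat.sub_one_lt_floor _).le
    have h2 : ((⌊L * (Q y / τ)⌋₊ : ℕ) : ℝ) ≤
        (Finset.univ.filter fun x => f x = ⟨y, hy⟩).card := by exact_mod_cast hf ⟨y, hy⟩
    -- The threshold `Q y ≥ 2 ^ (-b)` turns the additive rounding loss of at most `1` into a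
    -- relative loss of at most `2 ^ b / L`.
    have h3 : 1 ≤ 2 ^ b * (Q y / τ) := by
      have : Q y ≤ Q y / τ := le_div_self (Q.2.1 y) hQ hτ1
      calc (1 : ℝ) = 2 ^ b * 2 ^ (-b) := by
            rw [Real.rpow_neg (by norm_num), mul_inv_cancel₀ hpow.ne']
        _ ≤ 2 ^ b * (Q y / τ) := by gcongr; exact hQy.trans this
    have h4 : (1 - 2 ^ b / L) * (Q y / τ) * L = L * (Q y / τ) - 2 ^ b * (Q y / τ) := by
      field_simp
    linarith
  rcases le_or_gt (1 - 2 ^ b / L) 0 with hneg | hpos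
  · rw [Real.sqrt_eq_zero_of_nonpos hneg, zero_mul]
    exact fidelity_nonneg _ _
  calc √(1 - 2 ^ b / L) * √τ = ∑ y ∈ s, √((1 - 2 ^ b / L) * (Q y / τ)) * √(Q y) := by
        have : ∀ y ∈ s, √((1 - 2 ^ b / L) * (Q y / τ)) * √(Q y) =
            √(1 - 2 ^ b / L) * (Q y / √τ) := fun y _ => by
          have h0 : 0 ≤ Q y := Q.2.1 y
          rw [Real.sqrt_mul hpos.le, Real.sqrt_div h0, mul_assoc, div_mul_eq_mul_div,
            Real.mul_self_sqrt h0]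
        rw [Finset.sum_congr rfl this, ← Finset.mul_sum, ← Finset.sum_div, ← hτs, Real.div_sqrt]
    _ ≤ ∑ y ∈ s, √(stdSimplex.map (fun x => (f x : Y)) (uniformDist X) y) * √(Q y) := by
        refine Finset.sum_le_sum fun y hy => ?_
        gcongr
        exact hlow y hy
    _ ≤ _ := Finset.sum_le_sum_of_subset_of_nonneg (Finset.subset_univ s)
        fun y _ _ => by positivity

lemma iid_uniformDist [Nonempty X] (n : ℕ) :
    (uniformDist X).iid n = uniformDist (Fin n → X) := by
  refine stdSimplex.ext (funext fun x => ?_)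
  have h1 : ((uniformDist X).iid n) x = ∏ i, (uniformDist X) (x i) := rfl
  have h2 : ∀ a, (uniformDist X) a = (Fintype.card X : ℝ)⁻¹ :=
    fun a => stdSimplex.barycenter_apply a
  have h3 : (uniformDist (Fin n → X)) x = (Fintype.card (Fin n → X) : ℝ)⁻¹ :=
    stdSimplex.barycenter_apply x
  rw [h1, h3]
  simp [h2]

end FixedLength

/-! ### The central limit theorem for the self-information -/

section SelfInformation

variable {Y : Type*} [Fintype Y]

lemma exists_eq_of_infoVariance_eq_zero {Q : ProbDist Y} (h : infoVariance Q = 0) :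
    ∀ y, Q y = 0 ∨ Q y = 2 ^ (-shannonEntropy Q) := by
  intro y
  have hterm := (Finset.sum_eq_zero_iff_of_nonneg fun y _ =>
    mul_nonneg (Q.2.1 y) (sq_nonneg (-Real.logb 2 (Q y) - shannonEntropy Q))).1 h y
    (Finset.mem_univ y)
  rcases (Q.2.1 y).eq_or_lt with h0 | h0
  · exact Or.inl h0.symm
  · right
    have h0' : 0 < Q y := h0
    rcases mul_eq_zero.1 hterm with h1 | h1
    · exact absurd h1 h0.ne'
    · have h2 : -shannonEntropy Q = Real.logb 2 (Q y) := by
        have := pow_eq_zero_iff (two_ne_zero) |>.1 h1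
        linarith
      rw [h2, Real.rpow_logb (by norm_num) (by norm_num) h0']

lemma infoVariance_nonneg (Q : ProbDist Y) : 0 ≤ infoVariance Q :=
  Finset.sum_nonneg fun y _ => mul_nonneg (Q.2.1 y) (sq_nonneg _)

lemma infoVariance_pos {Q : ProbDist Y} (hQ : ¬ IsUniformDist Q) : 0 < infoVariance Q :=
  (infoVariance_nonneg Q).lt_of_ne fun h =>
    hQ ⟨_, exists_eq_of_infoVariance_eq_zero h.symm⟩

lemma shannonEntropy_term_nonneg (Q : ProbDist Y) (y : Y) : 0 ≤ Q y * (-Real.logb 2 (Q y)) :=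
  mul_nonneg (Q.2.1 y) (neg_nonneg.2 (Real.logb_nonpos (by norm_num) (Q.2.1 y)
    (stdSimplex.le_one Q y)))

lemma shannonEntropy_pos {Q : ProbDist Y} (hQ : ¬ IsUniformDist Q) : 0 < shannonEntropy Q := by
  refine (Finset.sum_nonneg fun y _ => shannonEntropy_term_nonneg Q y).lt_of_ne fun h => hQ ⟨1, ?_⟩
  intro y
  have hterm := (Finset.sum_eq_zero_iff_of_nonneg fun y _ =>
    shannonEntropy_term_nonneg Q y).1 h.symm y (Finset.mem_univ y)
  rcases (Q.2.1 y).eq_or_lt with h0 | h0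
  · exact Or.inl h0.symm
  · right
    have h0' : 0 < Q y := h0
    rcases mul_eq_zero.1 hterm with h1 | h1
    · exact absurd h1 h0'.ne'
    · rw [neg_eq_zero, Real.logb_eq_zero] at h1
      rcases h1 with h1 | h1 | h1 | h1 | h1 | h1 <;> linarith

/-- The probability mass function of a distribution. -/
def ProbDist.toPMF (Q : ProbDist Y) : PMF Y :=
  PMF.ofFintype (fun y => ENNReal.ofReal (Q y)) (by
    have h : ∑ y, Q y = 1 := Q.2.2
    rw [← ENNReal.ofReal_sum_of_nonneg fun y _ => stdSimplex.zero_le Q y, h,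
      ENNReal.ofReal_one])

lemma ProbDist.toReal_toPMF (Q : ProbDist Y) (y : Y) : (Q.toPMF y).toReal = Q y := by
  rw [ProbDist.toPMF, PMF.ofFintype_apply, ENNReal.toReal_ofReal (stdSimplex.zero_le Q y)]

lemma two_rpow_neg_le_iid_iff (Q : ProbDist Y) {m : ℕ} (y : Fin m → Y) (a : ℝ)
    (hy : Q.iid m y ≠ 0) :
    (2 : ℝ) ^ (-a) ≤ Q.iid m y ↔ ∑ i, -Real.logb 2 (Q (y i)) ≤ a := by
  have hprod : Q.iid m y = ∏ i, Q (y i) := rfl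
  have hne : ∀ i, Q (y i) ≠ 0 := fun i h => hy (hprod ▸ Finset.prod_eq_zero (Finset.mem_univ i) h)
  have hpos : 0 < Q.iid m y := ((Q.iid m).2.1 y).lt_of_ne' hy
  rw [← Real.le_logb_iff_rpow_le (by norm_num) hpos, hprod, Real.logb_prod _ _ fun i _ => hne i,
    Finset.sum_neg_distrib, neg_le]

variable [MeasurableSpace Y] [DiscreteMeasurableSpace Y]

/-- All block lengths are realized on one infinite product space, where the central limit theorem
for a single i.i.d. sequence applies. -/
lemma typicalMass_iid (Q : ProbDist Y) (m : ℕ) (a : ℝ) :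
    typicalMass (Q.iid m) a = (Measure.infinitePi fun _ : ℕ => Q.toPMF.toMeasure).real
      {ω | ∑ k ∈ Finset.range m, -Real.logb 2 (Q (ω k)) ≤ a} := by
  classical
  set s : Finset (Fin m → Y) := Finset.univ.filter fun y => ∑ i, -Real.logb 2 (Q (y i)) ≤ a
  have hset : {ω : ℕ → Y | ∑ k ∈ Finset.range m, -Real.logb 2 (Q (ω k)) ≤ a} =
      (fun ω (i : Fin m) => ω (i : ℕ)) ⁻¹' (s : Set (Fin m → Y)) := by
    ext ω
    simp [s, Finset.sum_range]
  have hmap : (Measure.infinitePi fun _ : ℕ => Q.toPMF.toMeasure).map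
      (fun ω (i : Fin m) => ω (i : ℕ)) = Measure.pi fun _ : Fin m => Q.toPMF.toMeasure := by
    rw [Measure.map_infinitePi_infinitePi_of_inj (P := fun _ : ℕ => Q.toPMF.toMeasure)
      (f := fun i : Fin m => (i : ℕ)) Fin.val_injective,
      Measure.infinitePi_eq_pi]
  have hsingle : ∀ y : Fin m → Y,
      (Measure.pi fun _ : Fin m => Q.toPMF.toMeasure).real {y} = Q.iid m y := by
    intro y
    rw [Measure.real, Measure.pi_singleton, ENNReal.toReal_prod]
    refine Finset.prod_congr rfl fun i _ => ?_
    rw [PMF.toMeasure_apply_singleton _ _ (MeasurableSet.singleton _), ProbDist.toReal_toPMF]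
  rw [hset, ← map_measureReal_apply (by fun_prop) s.measurableSet, hmap,
    ← sum_measureReal_singleton]
  simp_rw [hsingle]
  rw [typicalMass, Finset.sum_filter, Finset.sum_filter]
  refine Finset.sum_congr rfl fun y _ => ?_
  -- Words of probability zero may satisfy the sum condition, since `logb 2 0 = 0`, but they add
  -- nothing to either side.
  by_cases hy : Q.iid m y = 0
  · simp [hy]
  · simp only [two_rpow_neg_le_iid_iff Q y a hy]

lemma integral_toPMF (Q : ProbDist Y) (f : Y → ℝ) :
    ∫ y, f y ∂Q.toPMF.toMeasure = ∑ y, Q y * f y := by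
  rw [PMF.integral_eq_sum]
  simp [ProbDist.toReal_toPMF]

lemma variance_neg_logb (Q : ProbDist Y) :
    Var[fun y => -Real.logb 2 (Q y); Q.toPMF.toMeasure] = infoVariance Q := by
  rw [variance_eq_integral Measurable.of_discrete.aemeasurable, integral_toPMF, integral_toPMF]
  rfl

end SelfInformation

/-! ### Moving thresholds and the normal distribution function -/

/-- Comparing `u i` with fixed points on either side of `x` lets monotonicity replace uniform
convergence. This is needed because the central limit theorem is stated at a fixed threshold,
whereas the thresholds here vary with `n`. -/
lemma tendsto_monotone_apply {ι : Type*} {l : Filter ι} {F : ι → ℝ → ℝ} {G : ℝ → ℝ}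
    (hmono : ∀ i, Monotone (F i)) (hG : Continuous G)
    (hF : ∀ x, Tendsto (fun i => F i x) l (𝓝 (G x))) {u : ι → ℝ} {x : ℝ}
    (hu : Tendsto u l (𝓝 x)) : Tendsto (fun i => F i (u i)) l (𝓝 (G x)) := by
  rw [tendsto_order]
  constructor
  · intro c hc
    obtain ⟨y, hyc, hyx⟩ : ∃ y, c < G y ∧ y < x :=
      (((hG.tendsto x).eventually_const_lt hc).filter_mono nhdsWithin_le_nhds |>.and
        (self_mem_nhdsWithin : Set.Iio x ∈ 𝓝[<] x)).exists
    filter_upwards [(hF y).eventually_const_lt hyc, hu.eventually_const_lt hyx] with i h1 h2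
    exact h1.trans_le (hmono i h2.le)
  · intro c hc
    obtain ⟨y, hyc, hyx⟩ : ∃ y, G y < c ∧ x < y :=
      (((hG.tendsto x).eventually_lt_const hc).filter_mono nhdsWithin_le_nhds |>.and
        (self_mem_nhdsWithin : Set.Ioi x ∈ 𝓝[>] x)).exists
    filter_upwards [(hF y).eventually_lt_const hyc, hu.eventually_lt_const hyx] with i h1 h2
    exact (hmono i h2.le).trans_lt h1

lemma stdNormalCDF_eq_real (x : ℝ) : stdNormalCDF x = (gaussianReal 0 1).real (Set.Iic x) :=
  cdf_eq_real _ x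

lemma gaussianReal_real_Iic (μ x : ℝ) {v : ℝ} (hv : 0 < v) :
    (gaussianReal μ v.toNNReal).real (Set.Iic x) = stdNormalCDF ((x - μ) / √v) := by
  have hs : 0 < √v := Real.sqrt_pos.2 hv
  have hmap : gaussianReal μ v.toNNReal = (gaussianReal 0 1).map fun y => √v * y + μ := by
    rw [show (fun y => √v * y + μ) = (fun x => x + μ) ∘ fun x => √v * x from rfl,
      ← Measure.map_map (by fun_prop) (by fun_prop), gaussianReal_map_const_mul,
      gaussianReal_map_add_const]
    congr 1
    · simp
    · ext; simp [Real.sq_sqrt hv.le, hv.le]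
  rw [hmap, map_measureReal_apply (by fun_prop) measurableSet_Iic, stdNormalCDF_eq_real]
  congr 1
  ext y
  simp only [Set.mem_preimage, Set.mem_Iic]
  rw [le_div_iff₀ hs, le_sub_iff_add_le, mul_comm]

lemma hasDerivAt_integral_Iic {h : ℝ → ℝ} (hc : Continuous h) (hi : Integrable h) (x : ℝ) :
    HasDerivAt (fun x => ∫ t in Set.Iic x, h t) (h x) x := by
  have heq : (fun x => ∫ t in Set.Iic x, h t) =
      fun x => (∫ t in Set.Iic 0, h t) + ∫ t in (0 : ℝ)..x, h t := by
    funext x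
    rw [← intervalIntegral.integral_Iic_sub_Iic hi.integrableOn hi.integrableOn]
    ring
  rw [heq]
  exact (hc.integral_hasStrictDerivAt 0 x).hasDerivAt.const_add _

lemma continuous_gaussianPDFReal (μ : ℝ) (v : NNReal) : Continuous (gaussianPDFReal μ v) := by
  unfold gaussianPDFReal
  fun_prop

lemma hasDerivAt_stdNormalCDF (x : ℝ) :
    HasDerivAt stdNormalCDF (gaussianPDFReal 0 1 x) x := by
  have heq : stdNormalCDF = fun x => ∫ t in Set.Iic x, gaussianPDFReal 0 1 t := by
    funext x
    rw [stdNormalCDF_eq_real, Measure.real, gaussianReal_apply_eq_integral _ one_ne_zero,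
      ENNReal.toReal_ofReal (setIntegral_nonneg measurableSet_Iic
        fun t _ => gaussianPDFReal_nonneg 0 1 t)]
  rw [heq]
  exact hasDerivAt_integral_Iic (continuous_gaussianPDFReal 0 1) (integrable_gaussianPDFReal 0 1) x

lemma continuous_stdNormalCDF : Continuous stdNormalCDF :=
  continuous_iff_continuousAt.2 fun x => (hasDerivAt_stdNormalCDF x).continuousAt

lemma tendsto_real_le_of_tendstoInDistribution {Ω : Type*} [MeasurableSpace Ω] {μ : Measure Ω}
    [IsProbabilityMeasure μ] {γ : Measure ℝ} [IsProbabilityMeasure γ] [NullSingletonClass γ]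
    {Z : ℕ → Ω → ℝ} (h : TendstoInDistribution Z atTop id (fun _ => μ) γ) (z : ℝ) :
    Tendsto (fun k => μ.real {ω | Z k ω ≤ z}) atTop (𝓝 (γ.real (Set.Iic z))) := by
  have h1 := ProbabilityMeasure.tendsto_measure_of_null_frontier_of_tendsto' h.tendsto
    (E := Set.Iic z) (by
      rw [ProbabilityMeasure.coe_mk, Measure.map_id, frontier_Iic, measure_singleton])
  simp only [ProbabilityMeasure.coe_mk, Measure.map_id] at h1
  refine ((ENNReal.tendsto_toReal (measure_ne_top γ _)).comp h1).congr fun k => ?_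
  simp only [Function.comp]
  rw [Measure.map_apply_of_aemeasurable (h.forall_aemeasurable k) measurableSet_Iic]
  rfl

lemma tendsto_real_selfInformation_le {Y : Type*} [Fintype Y] [MeasurableSpace Y]
    [DiscreteMeasurableSpace Y] (Q : ProbDist Y) (hQ : 0 < infoVariance Q) (z : ℝ) :
    Tendsto (fun k : ℕ => (Measure.infinitePi fun _ : ℕ => Q.toPMF.toMeasure).real
      {ω | (√k)⁻¹ * (∑ j ∈ Finset.range k, -Real.logb 2 (Q (ω j)) - k * shannonEntropy Q) ≤ z})
      atTop (𝓝 (stdNormalCDF (z / √(infoVariance Q)))) := by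
  set μ := Measure.infinitePi fun _ : ℕ => Q.toPMF.toMeasure
  set X : ℕ → (ℕ → Y) → ℝ := fun k ω => -Real.logb 2 (Q (ω k))
  have hmeas : Measurable fun y => -Real.logb 2 (Q y) := Measurable.of_discrete
  have hpres : ∀ i : ℕ, MeasurePreserving (fun ω : ℕ → Y => ω i) μ Q.toPMF.toMeasure :=
    fun i => measurePreserving_eval_infinitePi _ i
  have hmean : μ[X 0] = shannonEntropy Q := by
    rw [shannonEntropy, ← integral_toPMF Q fun y => -Real.logb 2 (Q y),
      ← (hpres 0).map_eq, integral_map (hpres 0).aemeasurable hmeas.aestronglyMeasurable]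
  have hvar : Var[X 0; μ] = infoVariance Q := by
    rw [← variance_neg_logb]
    exact (hpres 0).variance_fun_comp hmeas.aemeasurable
  have hident : ∀ i, IdentDistrib (X i) (X 0) μ μ := fun i => by
    refine IdentDistrib.comp (f := fun ω : ℕ → Y => ω i) (g := fun ω : ℕ → Y => ω 0)
      ⟨(hpres i).aemeasurable, (hpres 0).aemeasurable, ?_⟩ hmeas
    rw [(hpres i).map_eq, (hpres 0).map_eq]
  have hmemLp : MemLp (X 0) 2 μ := by
    have : MemLp (fun y => -Real.logb 2 (Q y)) 2 Q.toPMF.toMeasure := MemLp.of_discrete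
    exact this.comp_measurePreserving (hpres 0)
  have hclt := tendstoInDistribution_inv_sqrt_mul_sum_sub (P := μ) (X := X)
    (P' := gaussianReal 0 Var[X 0; μ].toNNReal) (Y := id) ⟨aemeasurable_id, Measure.map_id⟩ hmemLp
    (iIndepFun_infinitePi fun _ => hmeas) hident
  rw [hmean] at hclt
  have hns := nullSingletonClass_gaussianReal (μ := 0) (v := Var[X 0; μ].toNNReal)
    (by rw [hvar]; exact (Real.toNNReal_pos.2 hQ).ne')
  have h := tendsto_real_le_of_tendstoInDistribution hclt z
  rwa [hvar, gaussianReal_real_Iic 0 z hQ, sub_zero] at h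

lemma tendsto_typicalMass_iid {Y : Type*} [Fintype Y] (Q : ProbDist Y) (hQ : 0 < infoVariance Q)
    {m : ℕ → ℕ} (hm : Tendsto m atTop atTop) {a : ℕ → ℝ} {x : ℝ}
    (ha : Tendsto (fun n => (a n - m n * shannonEntropy Q) / √(m n)) atTop (𝓝 x)) :
    Tendsto (fun n => typicalMass (Q.iid (m n)) (a n)) atTop
      (𝓝 (stdNormalCDF (x / √(infoVariance Q)))) := by
  let _ : MeasurableSpace Y := ⊤
  have : DiscreteMeasurableSpace Y := ⟨fun _ => trivial⟩
  have hcont : Continuous fun z => stdNormalCDF (z / √(infoVariance Q)) :=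
    continuous_stdNormalCDF.comp (by fun_prop)
  have key := tendsto_monotone_apply
    (F := fun n z => (Measure.infinitePi fun _ : ℕ => Q.toPMF.toMeasure).real
      {ω | (√(m n))⁻¹ * (∑ j ∈ Finset.range (m n), -Real.logb 2 (Q (ω j)) -
        m n * shannonEntropy Q) ≤ z})
    (fun n y z hyz => measureReal_mono fun ω hω => by
      simp only [Set.mem_ofPred_eq] at hω ⊢
      exact hω.trans hyz)
    hcont (fun z => (tendsto_real_selfInformation_le Q hQ z).comp hm) ha
  refine key.congr' ?_
  filter_upwards [hm.eventually_gt_atTop 0] with n hn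
  rw [typicalMass_iid]
  have hs : 0 < √(m n : ℝ) := Real.sqrt_pos.2 (by exact_mod_cast hn)
  congr 1
  ext ω
  simp only [Set.mem_ofPred_eq]
  rw [inv_mul_le_iff₀ hs, mul_div_cancel₀ _ hs.ne', sub_le_sub_iff_right]

/-! ### Second-order asymptotics of the maximal fidelity -/

lemma tendsto_sub_div_sqrt_of_isLittleO {S : ℕ → ℝ} {c s : ℝ}
    (h : (fun n : ℕ => S n - (c * n + s * √n)) =o[atTop] fun n : ℕ => √(n : ℝ)) :
    Tendsto (fun n : ℕ => (S n - c * n) / √n) atTop (𝓝 s) := by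
  have h1 := h.tendsto_div_nhds_zero.add_const s
  rw [zero_add] at h1
  refine h1.congr' ?_
  filter_upwards [eventually_gt_atTop 0] with n hn
  have : √(n : ℝ) ≠ 0 := (Real.sqrt_pos.2 (by exact_mod_cast hn)).ne'
  field_simp
  ring

lemma tendsto_sqrt_natCast : Tendsto (fun n : ℕ => √(n : ℝ)) atTop atTop :=
  Real.tendsto_sqrt_atTop.comp tendsto_natCast_atTop_atTop

lemma tendsto_div_self_of_tendsto_sub_div_sqrt {T : ℕ → ℝ} {r t : ℝ}
    (h : Tendsto (fun n : ℕ => (T n - r * n) / √n) atTop (𝓝 t)) :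
    Tendsto (fun n : ℕ => T n / n) atTop (𝓝 r) := by
  have h1 := (h.div_atTop tendsto_sqrt_natCast).add_const r
  rw [zero_add] at h1
  refine h1.congr' ?_
  filter_upwards [eventually_gt_atTop 0] with n hn
  have h0 : (n : ℝ) ≠ 0 := by exact_mod_cast hn.ne'
  rw [div_div, Real.mul_self_sqrt (Nat.cast_nonneg n)]
  field_simp
  ring

lemma tendsto_atTop_of_tendsto_div {T : ℕ → ℝ} {r : ℝ} (hr : 0 < r)
    (h : Tendsto (fun n : ℕ => T n / n) atTop (𝓝 r)) : Tendsto T atTop atTop := by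
  refine (h.pos_mul_atTop hr tendsto_natCast_atTop_atTop).congr' ?_
  filter_upwards [eventually_gt_atTop 0] with n hn
  rw [div_mul_cancel₀]
  exact_mod_cast hn.ne'

lemma tendsto_floor_sub_div_sqrt {T : ℕ → ℝ} {r t : ℝ} (hr : 0 < r)
    (h : Tendsto (fun n : ℕ => (T n - r * n) / √n) atTop (𝓝 t)) :
    Tendsto (fun n : ℕ => ((⌊T n⌋₊ : ℝ) - r * n) / √n) atTop (𝓝 t) := by
  have hT := tendsto_atTop_of_tendsto_div hr (tendsto_div_self_of_tendsto_sub_div_sqrt h)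
  have h1 : Tendsto (fun n : ℕ => (T n - r * n) / √n - 1 / √n) atTop (𝓝 t) := by
    simpa using h.sub (tendsto_const_nhds.div_atTop tendsto_sqrt_natCast (a := (1 : ℝ)))
  refine tendsto_of_tendsto_of_tendsto_of_le_of_le' h1 h ?_ ?_
  · refine Eventually.of_forall fun n => ?_
    rw [← sub_div]
    refine div_le_div_of_nonneg_right ?_ (Real.sqrt_nonneg _)
    linarith [Nat.sub_one_lt_floor (T n)]
  · filter_upwards [hT.eventually_ge_atTop 0] with n hn
    gcongr
    exact Nat.floor_le hn

/-- Here `b n - m n * H(Q)` is `(c - H(Q) t) √n + o(√n)`, and `√(m n)` is asymptotic to `√(r n)`. -/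
lemma tendsto_typicalMass_of_secondOrder {Y : Type*} [Fintype Y] {Q : ProbDist Y}
    (hQ : ¬ IsUniformDist Q) {m : ℕ → ℕ} {b : ℕ → ℝ} {c t r : ℝ} (hr : 0 < r)
    (hm : Tendsto (fun n : ℕ => ((m n : ℝ) - r * n) / √n) atTop (𝓝 t))
    (hb : Tendsto (fun n : ℕ => (b n - r * shannonEntropy Q * n) / √n) atTop (𝓝 c)) :
    Tendsto (fun n => typicalMass (Q.iid (m n)) (b n)) atTop
      (𝓝 (stdNormalCDF ((c - shannonEntropy Q * t) / √(r * infoVariance Q)))) := by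
  have hdiv := tendsto_div_self_of_tendsto_sub_div_sqrt hm
  have hmtop : Tendsto m atTop atTop :=
    tendsto_natCast_atTop_iff.1 (tendsto_atTop_of_tendsto_div hr hdiv)
  have hsr : √r ≠ 0 := (Real.sqrt_pos.2 hr).ne'
  rw [Real.sqrt_mul hr.le, ← div_div]
  refine tendsto_typicalMass_iid Q (infoVariance_pos hQ) hmtop ?_
  refine ((hb.sub (hm.const_mul (shannonEntropy Q))).div (hdiv.sqrt) hsr).congr' ?_
  filter_upwards [eventually_gt_atTop 0, hmtop.eventually_gt_atTop 0] with n hn hmn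
  have h1 : √(n : ℝ) ≠ 0 := (Real.sqrt_pos.2 (by exact_mod_cast hn)).ne'
  have h2 : √(m n : ℝ) ≠ 0 := (Real.sqrt_pos.2 (by exact_mod_cast hmn)).ne'
  simp only [Pi.div_apply]
  rw [Real.sqrt_div (Nat.cast_nonneg _)]
  field_simp
  ring

/-- The slack `√√n` is chosen to be unbounded, so that `2 ^ (-√√n)` vanishes, and yet `o(√n)`, hence
invisible at second order. -/
lemma tendsto_sqrt_sqrt_natCast : Tendsto (fun n : ℕ => √√(n : ℝ)) atTop atTop :=
  Real.tendsto_sqrt_atTop.comp tendsto_sqrt_natCast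

lemma tendsto_sqrt_sqrt_div_sqrt :
    Tendsto (fun n : ℕ => √√(n : ℝ) / √(n : ℝ)) atTop (𝓝 0) := by
  refine tendsto_sqrt_sqrt_natCast.inv_tendsto_atTop.congr fun n => ?_
  rw [Pi.inv_apply, Real.sqrt_div_self']
  simp

lemma tendsto_two_rpow_neg_sqrt_sqrt :
    Tendsto (fun n : ℕ => (2 : ℝ) ^ (-√√(n : ℝ))) atTop (𝓝 0) := by
  have := (tendsto_rpow_atBot_of_base_gt_one 2 one_lt_two).comp
    (tendsto_neg_atTop_atBot.comp tendsto_sqrt_sqrt_natCast)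
  exact this

lemma tendsto_min_sub_div_sqrt {S : ℕ → ℝ} {c s : ℝ}
    (hS : Tendsto (fun n : ℕ => (S n - c * n) / √n) atTop (𝓝 s)) (u : ℕ → ℝ)
    (hu : Tendsto (fun n : ℕ => u n / √n) atTop (𝓝 0)) :
    Tendsto (fun n : ℕ => (min (S n) (c * n) + u n - c * n) / √n) atTop (𝓝 (min s 0)) := by
  have h := (hS.min (tendsto_const_nhds (x := (0 : ℝ)))).add hu
  rw [add_zero] at h
  refine h.congr' ?_
  filter_upwards [eventually_gt_atTop 0] with n hn
  have h1 : 0 < √(n : ℝ) := Real.sqrt_pos.2 (by exact_mod_cast hn)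
  have h2 : min ((S n - c * n) / √n) 0 = min (S n - c * n) 0 / √n := by
    rw [← min_div_div_right h1.le, zero_div]
  have h3 : min (S n - c * n) 0 = min (S n) (c * n) - c * n := by
    rw [← min_sub_sub_right, sub_self]
  rw [h2, h3]
  ring

lemma logb_card_pos (X : Type*) [Fintype X] [Nontrivial X] :
    0 < Real.logb 2 (Fintype.card X) :=
  Real.logb_pos one_lt_two (by exact_mod_cast Fintype.one_lt_card)

lemma two_rpow_logb_card_mul (X : Type*) [Fintype X] [Nonempty X] (n : ℕ) :
    (2 : ℝ) ^ (Real.logb 2 (Fintype.card X) * n) = (Fintype.card (Fin n → X) : ℝ) := by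
  have h : (0 : ℝ) < Fintype.card X := by exact_mod_cast Fintype.card_pos
  rw [Real.rpow_mul (by norm_num), Real.rpow_logb (by norm_num) (by norm_num) h, Real.rpow_natCast]
  simp

theorem tendsto_maxFidelity_uniform {X Y : Type*} [Fintype X] [Nontrivial X] [Fintype Y]
    {Q : ProbDist Y} (hQ : ¬ IsUniformDist Q) {s t : ℝ} (i : Conversion) {S T : ℕ → ℝ}
    (hS : (fun n : ℕ => S n - (Real.logb 2 (Fintype.card X) * n + s * √n))
      =o[atTop] fun n : ℕ => √(n : ℝ))
    (hT : (fun n : ℕ => T n - (Real.logb 2 (Fintype.card X) / shannonEntropy Q * n + t * √n))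
      =o[atTop] fun n : ℕ => √(n : ℝ)) :
    Tendsto (fun n => maxFidelity i ((uniformDist X).iid n) (Q.iid ⌊T n⌋₊) (S n)) atTop
      (𝓝 √(stdNormalCDF
        (√(shannonEntropy Q / (infoVariance Q * Real.logb 2 (Fintype.card X))) *
          (min s 0 - shannonEntropy Q * t)))) := by
  have hl := logb_card_pos X
  have hcard := two_rpow_logb_card_mul X
  set l := Real.logb 2 (Fintype.card X)
  have hH := shannonEntropy_pos hQ
  have hV := infoVariance_pos hQ
  have hr : 0 < l / shannonEntropy Q := div_pos hl hH
  have hm := tendsto_floor_sub_div_sqrt hr (tendsto_sub_div_sqrt_of_isLittleO hT)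
  have hS' := tendsto_sub_div_sqrt_of_isLittleO hS
  have hmass : ∀ u : ℕ → ℝ, Tendsto (fun n : ℕ => u n / √n) atTop (𝓝 0) →
      Tendsto (fun n => typicalMass (Q.iid ⌊T n⌋₊) (min (S n) (l * n) + u n)) atTop
        (𝓝 (stdNormalCDF (√(shannonEntropy Q / (infoVariance Q * l)) *
          (min s 0 - shannonEntropy Q * t)))) := by
    intro u hu
    have h := tendsto_typicalMass_of_secondOrder hQ (c := min s 0) hr hm
      (b := fun n => min (S n) (l * n) + u n) (by
        rw [div_mul_cancel₀ _ hH.ne']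
        exact tendsto_min_sub_div_sqrt hS' u hu)
    convert h using 3
    rw [div_eq_inv_mul (min s 0 - _), ← Real.sqrt_inv]
    congr 2
    field_simp
  have hplus := hmass (fun n => √√(n : ℝ)) tendsto_sqrt_sqrt_div_sqrt
  have hminus := hmass (fun n => -√√(n : ℝ)) (by
    simpa [neg_div] using tendsto_sqrt_sqrt_div_sqrt.neg)
  have hz := tendsto_two_rpow_neg_sqrt_sqrt
  have hlow : Tendsto (fun n : ℕ => √(1 - (2 : ℝ) ^ (-√√(n : ℝ))) *
      √(typicalMass (Q.iid ⌊T n⌋₊) (min (S n) (l * n) + -√√(n : ℝ)))) atTop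
      (𝓝 √(stdNormalCDF (√(shannonEntropy Q / (infoVariance Q * l)) *
          (min s 0 - shannonEntropy Q * t)))) := by
    simpa using (hz.const_sub 1).sqrt.mul hminus.sqrt
  have hupp : Tendsto (fun n : ℕ => √((2 : ℝ) ^ (-√√(n : ℝ)) +
      typicalMass (Q.iid ⌊T n⌋₊) (min (S n) (l * n) + √√(n : ℝ)))) atTop
      (𝓝 √(stdNormalCDF (√(shannonEntropy Q / (infoVariance Q * l)) *
          (min s 0 - shannonEntropy Q * t)))) := by
    simpa using (hz.add hplus).sqrt
  refine tendsto_of_tendsto_of_tendsto_of_le_of_le hlow hupp (fun n => ?_) fun n => ?_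
  · have hD : √(1 - (2 : ℝ) ^ (-√√(n : ℝ))) *
        √(typicalMass (Q.iid ⌊T n⌋₊) (min (S n) (l * n) + -√√(n : ℝ))) ≤
        maxFidelity .deterministic ((uniformDist X).iid n) (Q.iid ⌊T n⌋₊) (S n) := by
      rw [iid_uniformDist]
      refine le_trans ?_ (le_maxFidelity_uniform (Q.iid ⌊T n⌋₊)
        (b := min (S n) (l * n) + -√√(n : ℝ)) ?_)
      · gcongr
        rw [← hcard, ← Real.rpow_sub (by norm_num)]
        refine Real.rpow_le_rpow_of_exponent_le (by norm_num) ?_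
        linarith [min_le_right (S n) (l * n)]
      · linarith [min_le_left (S n) (l * n), Real.sqrt_nonneg √(n : ℝ)]
    cases i
    · exact hD
    · exact hD.trans (maxFidelity_deterministic_le_majorization _ _ _)
  · refine (maxFidelity_le i _ _ _ (min (S n) (l * n) + √√(n : ℝ))).trans ?_
    gcongr
    rw [← hcard, min_comm, ← (Real.monotone_rpow_of_base_ge_one one_le_two).map_min,
      ← Real.rpow_add (by norm_num)]
    exact Real.rpow_le_rpow_of_exponent_le (by norm_num) (by linarith)

lemma shannonEntropy_uniformDist (X : Type*) [Fintype X] [Nonempty X] :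
    shannonEntropy (uniformDist X) = Real.logb 2 (Fintype.card X) := by
  have h2 : ∀ a, (uniformDist X) a = (Fintype.card X : ℝ)⁻¹ :=
    fun a => stdSimplex.barycenter_apply a
  have h : (Fintype.card X : ℝ) ≠ 0 := by exact_mod_cast Fintype.card_ne_zero
  simp [shannonEntropy, h2, Real.logb_inv, h]

/-! ### The generalized Rayleigh-normal distribution for large scale -/

lemma integrable_sqrt_mul {α : Type*} [MeasurableSpace α] {ν : Measure α} {f g : α → ℝ}
    (hf : ∀ x, 0 ≤ f x) (hg : ∀ x, 0 ≤ g x) (hfi : Integrable f ν) (hgi : Integrable g ν) :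
    Integrable (fun x => √(f x * g x)) ν := by
  refine (hfi.add hgi).mono' ((hfi.aemeasurable.mul hgi.aemeasurable).sqrt.aestronglyMeasurable)
    (ae_of_all _ fun x => ?_)
  rw [Real.norm_of_nonneg (Real.sqrt_nonneg _), Pi.add_apply]
  refine Real.sqrt_le_iff.2 ⟨add_nonneg (hf x) (hg x), ?_⟩
  nlinarith [hf x, hg x, mul_nonneg (hf x) (hg x)]

/-- The Cauchy-Schwarz inequality for the continuous fidelity. -/
lemma integral_sqrt_mul_le {α : Type*} [MeasurableSpace α] {ν : Measure α} {f g : α → ℝ}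
    (hf : ∀ x, 0 ≤ f x) (hg : ∀ x, 0 ≤ g x) (hfi : Integrable f ν) (hgi : Integrable g ν) :
    ∫ x, √(f x * g x) ∂ν ≤ √(∫ x, f x ∂ν) * √(∫ x, g x ∂ν) := by
  have hmem : ∀ {h : α → ℝ}, (∀ x, 0 ≤ h x) → Integrable h ν →
      MemLp (fun x => √(h x)) (ENNReal.ofReal 2) ν := by
    intro h h0 hi
    rw [ENNReal.ofReal_ofNat, memLp_two_iff_integrable_sq hi.aemeasurable.sqrt.aestronglyMeasurable]
    simpa [Real.sq_sqrt (h0 _)] using hi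
  have key := integral_mul_le_Lp_mul_Lq_of_nonneg Real.HolderConjugate.two_two
    (ae_of_all ν fun x => Real.sqrt_nonneg (f x)) (ae_of_all ν fun x => Real.sqrt_nonneg (g x))
    (hmem hf hfi) (hmem hg hgi)
  have hrpow : ∀ z : ℝ, z ^ (2 : ℝ)⁻¹ = √z := fun z => by rw [Real.sqrt_eq_rpow, one_div]
  simpa [Real.sqrt_mul (hf _), Real.sq_sqrt (hf _), Real.sq_sqrt (hg _), hrpow] using key

section RayleighClass

variable {A : ℝ → ℝ}

/-- By the change of variables formula the integral of `deriv A` over `s` is the length of `A '' s`.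
Integrability thus needs no limits of `A` at infinity. -/
lemma integrableOn_deriv_of_image_subset (hA : Differentiable ℝ A) (hm : Monotone A)
    (hc : Continuous (deriv A)) {s : Set ℝ} (hs : MeasurableSet s) {a b : ℝ} (hab : a ≤ b)
    (himg : A '' s ⊆ Set.Icc a b) :
    IntegrableOn (deriv A) s ∧ ∫ x in s, deriv A x ≤ b - a := by
  have h0 : ∀ x, 0 ≤ deriv A x := fun x => hm.deriv_nonneg
  have hl : ∫⁻ x in s, ENNReal.ofReal (deriv A x) ≤ ENNReal.ofReal (b - a) := by
    rw [lintegral_deriv_eq_volume_image_of_monotoneOn hs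
      (fun x _ => (hA x).hasDerivAt.hasDerivWithinAt) (hm.monotoneOn s), ← Real.volume_Icc]
    exact measure_mono himg
  refine ⟨⟨hc.aestronglyMeasurable, ?_⟩, ?_⟩
  · rw [hasFiniteIntegral_iff_ofReal (ae_of_all _ h0)]
    exact hl.trans_lt ENNReal.ofReal_lt_top
  · rw [integral_eq_lintegral_of_nonneg_ae (ae_of_all _ h0) hc.aestronglyMeasurable]
    exact ENNReal.toReal_le_of_le_ofReal (sub_nonneg.2 hab) hl

lemma setIntegral_gaussianPDFReal_Iic (μ d : ℝ) {v : ℝ} (hv : 0 < v) :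
    ∫ x in Set.Iic d, gaussianPDFReal μ v.toNNReal x = stdNormalCDF ((d - μ) / √v) := by
  rw [← gaussianReal_real_Iic μ d hv, Measure.real,
    gaussianReal_apply_eq_integral _ (Real.toNNReal_pos.2 hv).ne',
    ENNReal.toReal_ofReal (setIntegral_nonneg measurableSet_Iic
      fun t _ => gaussianPDFReal_nonneg _ _ t)]

lemma stdNormalCDF_nonneg (x : ℝ) : 0 ≤ stdNormalCDF x := cdf_nonneg _ x

lemma stdNormalCDF_le_one (x : ℝ) : stdNormalCDF x ≤ 1 := cdf_le_one _ x

lemma monotone_stdNormalCDF : Monotone stdNormalCDF := monotone_cdf _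

/-- Cauchy-Schwarz on each side of `d`: on the left `deriv A` has mass at most `1`, on the right at
most `1 - A d`, while the normal density has mass at most `1` there. -/
lemma contFidelity_le {s : ℝ} (hA : A ∈ rayleighClass s) (μ d : ℝ) {v : ℝ} (hv : 0 < v) :
    contFidelity (deriv A) (gaussianPDFReal μ v.toNNReal) ≤
      √(stdNormalCDF ((d - μ) / √v)) + √(1 - A d) := by
  obtain ⟨hcd, hm, -, hle⟩ := hA
  obtain ⟨hdiff, hcont⟩ := contDiff_one_iff_deriv.1 hcd
  have h0 : ∀ x, 0 ≤ deriv A x := fun x => hm.deriv_nonneg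
  have hA0 : ∀ x, 0 ≤ A x := fun x => (stdNormalCDF_nonneg x).trans (hle x).1
  have hg0 := gaussianPDFReal_nonneg μ v.toNNReal
  have hgi := integrable_gaussianPDFReal μ v.toNNReal
  obtain ⟨hi1, hb1⟩ := integrableOn_deriv_of_image_subset hdiff hm hcont
    (measurableSet_Iic (a := d)) zero_le_one (by rintro _ ⟨x, -, rfl⟩; exact ⟨hA0 x, (hle x).2⟩)
  obtain ⟨hi2, hb2⟩ := integrableOn_deriv_of_image_subset hdiff hm hcont
    (measurableSet_Ioi (a := d)) (hle d).2
    (by rintro _ ⟨x, hx, rfl⟩; exact ⟨hm (Set.mem_Ioi.1 hx).le, (hle x).2⟩)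
  rw [contFidelity, ← intervalIntegral.integral_Iic_add_Ioi
    (integrable_sqrt_mul h0 hg0 hi1 hgi.integrableOn)
    (integrable_sqrt_mul h0 hg0 hi2 hgi.integrableOn)]
  refine add_le_add ?_ ?_
  · refine (integral_sqrt_mul_le h0 hg0 hi1 hgi.integrableOn).trans ?_
    rw [setIntegral_gaussianPDFReal_Iic μ d hv]
    refine mul_le_of_le_one_left (Real.sqrt_nonneg _) (Real.sqrt_le_one.2 ?_)
    simpa using hb1
  · refine (integral_sqrt_mul_le h0 hg0 hi2 hgi.integrableOn).trans ?_
    refine (mul_le_of_le_one_right (Real.sqrt_nonneg _) (Real.sqrt_le_one.2 ?_)).trans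
      (Real.sqrt_le_sqrt hb2)
    rw [← integral_gaussianPDFReal_eq_one μ (Real.toNNReal_pos.2 hv).ne']
    exact setIntegral_le_integral hgi (ae_of_all _ hg0)

lemma contFidelity_nonneg (p q : ℝ → ℝ) : 0 ≤ contFidelity p q :=
  integral_nonneg fun _ => Real.sqrt_nonneg _

lemma one_sub_rayleighNormal (v s μ : ℝ) :
    1 - rayleighNormal v s μ = sSup {f : ℝ | ∃ A ∈ rayleighClass s,
      f = contFidelity (deriv A) (gaussianPDFReal μ v.toNNReal) ^ 2} := by
  rw [rayleighNormal, sub_sub_cancel]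

lemma contFidelity_sq_le {s : ℝ} (hA : A ∈ rayleighClass s) (μ : ℝ) {v : ℝ} (hv : 0 < v) :
    contFidelity (deriv A) (gaussianPDFReal μ v.toNNReal) ^ 2 ≤
      stdNormalCDF ((s - μ) / √v) := by
  have h := contFidelity_le hA μ s hv
  rw [hA.2.2.1, sub_self, Real.sqrt_zero, add_zero] at h
  exact (Real.le_sqrt (contFidelity_nonneg _ _) (stdNormalCDF_nonneg _)).1 h

lemma one_sub_rayleighNormal_le (s μ : ℝ) {v : ℝ} (hv : 0 < v) :
    1 - rayleighNormal v s μ ≤ stdNormalCDF ((s - μ) / √v) := by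
  rw [one_sub_rayleighNormal]
  refine Real.sSup_le ?_ (stdNormalCDF_nonneg _)
  rintro _ ⟨A, hA, rfl⟩
  exact contFidelity_sq_le hA μ hv

lemma one_sub_rayleighNormal_le_of_point (s μ d : ℝ) {v : ℝ} (hv : 0 < v) :
    1 - rayleighNormal v s μ ≤
      (√(stdNormalCDF ((d - μ) / √v)) + √(1 - stdNormalCDF d)) ^ 2 := by
  rw [one_sub_rayleighNormal]
  refine Real.sSup_le ?_ (sq_nonneg _)
  rintro _ ⟨A, hA, rfl⟩
  have h := contFidelity_le hA μ d hv
  have h0 := contFidelity_nonneg (deriv A) (gaussianPDFReal μ v.toNNReal)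
  gcongr
  refine h.trans ?_
  gcongr
  exact (hA.2.2.2 d).1

lemma one_sub_rayleighNormal_nonneg (v s μ : ℝ) : 0 ≤ 1 - rayleighNormal v s μ := by
  rw [one_sub_rayleighNormal]
  refine Real.sSup_nonneg ?_
  rintro _ ⟨A, -, rfl⟩
  exact sq_nonneg _

/-- The cutoff equal to `1` up to `a` and to `0` from `d` on, affine in between. -/
def cutoff (a d x : ℝ) : ℝ := max 0 (min 1 ((d - x) / (d - a)))

lemma continuous_cutoff (a d : ℝ) : Continuous (cutoff a d) := by
  unfold cutoff
  fun_prop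

lemma cutoff_nonneg (a d x : ℝ) : 0 ≤ cutoff a d x := le_max_left _ _

lemma cutoff_le_one (a d x : ℝ) : cutoff a d x ≤ 1 := max_le zero_le_one (min_le_left _ _)

lemma cutoff_of_le {a d x : ℝ} (had : a < d) (hx : x ≤ a) : cutoff a d x = 1 := by
  have : 1 ≤ (d - x) / (d - a) := by
    rw [one_le_div (sub_pos.2 had)]
    linarith
  simp [cutoff, this]

lemma cutoff_of_ge {a d x : ℝ} (had : a < d) (hx : d ≤ x) : cutoff a d x = 0 := by
  have : (d - x) / (d - a) ≤ 0 :=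
    div_nonpos_of_nonpos_of_nonneg (by linarith) (sub_pos.2 had).le
  exact max_eq_left ((min_le_right _ _).trans this)

/-- The witness `A = 1 - (1 - Φ)(1 - B)` is the distribution function of the minimum of a standard
normal variable and an independent one with density `h / κ`, where `h` is the target density cut off
continuously between `a` and `d`. So `A ≥ Φ`, and `A s = 1` because `B s = 1`. Below `d` its
derivative is at least `(1 - Φ(d)) h / κ`, whose squared fidelity with the target is at least `(1 -
Φ(d)) κ`. -/
lemma mul_stdNormalCDF_le_one_sub_rayleighNormal {s μ a d v : ℝ} (hv : 0 < v) (had : a < d)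
    (hds : d ≤ s) :
    (1 - stdNormalCDF d) * stdNormalCDF ((a - μ) / √v) ≤ 1 - rayleighNormal v s μ := by
  set N := gaussianPDFReal μ v.toNNReal with hN
  have hN0 : ∀ x, 0 ≤ N x := gaussianPDFReal_nonneg μ v.toNNReal
  have hNi : Integrable N := integrable_gaussianPDFReal μ v.toNNReal
  have hNc : Continuous N := continuous_gaussianPDFReal μ v.toNNReal
  set h : ℝ → ℝ := fun x => cutoff a d x * N x with hdef
  have hhc : Continuous h := (continuous_cutoff a d).mul hNc
  have hh0 : ∀ x, 0 ≤ h x := fun x => mul_nonneg (cutoff_nonneg a d x) (hN0 x)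
  have hhN : ∀ x, h x ≤ N x := fun x => mul_le_of_le_one_left (hN0 x) (cutoff_le_one a d x)
  have hhi : Integrable h := hNi.mono' hhc.aestronglyMeasurable
    (ae_of_all _ fun x => by rw [Real.norm_of_nonneg (hh0 x)]; exact hhN x)
  set κ := ∫ x, h x with hκ
  have hκ1 : stdNormalCDF ((a - μ) / √v) ≤ κ := by
    rw [← setIntegral_gaussianPDFReal_Iic μ a hv]
    refine le_trans (le_of_eq ?_) (setIntegral_le_integral (s := Set.Iic a) hhi (ae_of_all _ hh0))
    refine setIntegral_congr_fun measurableSet_Iic fun x hx => ?_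
    simp only [hdef, cutoff_of_le had hx, one_mul, hN]
  have hΦ1 : 0 ≤ 1 - stdNormalCDF d := sub_nonneg.2 (stdNormalCDF_le_one d)
  rcases (integral_nonneg (μ := volume) (f := h) hh0).eq_or_lt with hκ0 | hκ0
  · refine le_trans ?_ (one_sub_rayleighNormal_nonneg v s μ)
    exact mul_nonpos_of_nonneg_of_nonpos hΦ1 (hκ1.trans hκ0.symm.le)
  change 0 < κ at hκ0
  refine (mul_le_mul_of_nonneg_left hκ1 hΦ1).trans ?_
  set B : ℝ → ℝ := fun x => κ⁻¹ * ∫ t in Set.Iic x, h t with hB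
  have hBd : ∀ x, HasDerivAt B (κ⁻¹ * h x) x := fun x =>
    (hasDerivAt_integral_Iic hhc hhi x).const_mul _
  have hB1 : ∀ x, B x ≤ 1 := fun x => by
    rw [hB, inv_mul_le_one₀ hκ0]
    exact setIntegral_le_integral hhi (ae_of_all _ hh0)
  have hB0 : ∀ x, 0 ≤ B x := fun x =>
    mul_nonneg (inv_nonneg.2 hκ0.le) (setIntegral_nonneg measurableSet_Iic fun t _ => hh0 t)
  have hBs : B s = 1 := by
    simp only [hB]
    rw [setIntegral_eq_integral_of_forall_compl_eq_zero, inv_mul_cancel₀ hκ0.ne']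
    intro x hx
    have hx' : s < x := by simpa using hx
    simp [hdef, cutoff_of_ge had (hds.trans hx'.le)]
  have hBc : Continuous B := continuous_iff_continuousAt.2 fun x => (hBd x).continuousAt
  set A : ℝ → ℝ := fun x => 1 - (1 - stdNormalCDF x) * (1 - B x) with hA
  have hAd : ∀ x, HasDerivAt A
      (gaussianPDFReal 0 1 x * (1 - B x) + (1 - stdNormalCDF x) * (κ⁻¹ * h x)) x := fun x => by
    have := (((hasDerivAt_stdNormalCDF x).const_sub 1).mul ((hBd x).const_sub 1)).const_sub 1
    refine this.congr_deriv ?_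
    ring
  have hderiv : deriv A = fun x =>
      gaussianPDFReal 0 1 x * (1 - B x) + (1 - stdNormalCDF x) * (κ⁻¹ * h x) :=
    funext fun x => (hAd x).deriv
  have hA'0 : ∀ x, 0 ≤ deriv A x := fun x => by
    rw [hderiv]
    exact add_nonneg (mul_nonneg (gaussianPDFReal_nonneg 0 1 x) (sub_nonneg.2 (hB1 x)))
      (mul_nonneg (sub_nonneg.2 (stdNormalCDF_le_one x))
        (mul_nonneg (inv_nonneg.2 hκ0.le) (hh0 x)))
  have hAdiff : Differentiable ℝ A := fun x => (hAd x).differentiableAt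
  have hAcont : Continuous (deriv A) := by
    rw [hderiv]
    exact ((continuous_gaussianPDFReal 0 1).mul (continuous_const.sub hBc)).add
      ((continuous_const.sub continuous_stdNormalCDF).mul (continuous_const.mul hhc))
  have hAm : Monotone A := monotone_of_deriv_nonneg hAdiff hA'0
  have hAle : ∀ x, stdNormalCDF x ≤ A x ∧ A x ≤ 1 := fun x => by
    have h1 := sub_nonneg.2 (stdNormalCDF_le_one x)
    have h2 := sub_nonneg.2 (hB1 x)
    constructor
    · simp only [hA]
      nlinarith [mul_nonneg h1 (hB0 x)]
    · simp only [hA]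
      nlinarith [mul_nonneg h1 h2]
  have hmem : A ∈ rayleighClass s :=
    ⟨contDiff_one_iff_deriv.2 ⟨hAdiff, hAcont⟩, hAm, by simp [hA, hBs], hAle⟩
  have hbdd : BddAbove {f : ℝ | ∃ A ∈ rayleighClass s,
      f = contFidelity (deriv A) (gaussianPDFReal μ v.toNNReal) ^ 2} :=
    ⟨_, by rintro _ ⟨A, hA, rfl⟩; exact contFidelity_sq_le hA μ hv⟩
  rw [one_sub_rayleighNormal]
  refine le_trans ?_ (le_csSup hbdd ⟨A, hmem, rfl⟩)
  have hAi : Integrable (deriv A) := by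
    have := (integrableOn_deriv_of_image_subset hAdiff hAm hAcont MeasurableSet.univ zero_le_one
      (by rintro _ ⟨x, -, rfl⟩; exact ⟨(stdNormalCDF_nonneg x).trans (hAle x).1, (hAle x).2⟩)).1
    rwa [integrableOn_univ] at this
  have hpt : ∀ x, √((1 - stdNormalCDF d) * κ⁻¹) * h x ≤ √(deriv A x * N x) := by
    intro x
    rcases le_or_gt d x with hx | hx
    · simp [hdef, cutoff_of_ge had hx]
    refine Real.le_sqrt_of_sq_le ?_
    rw [mul_pow, Real.sq_sqrt (mul_nonneg hΦ1 (inv_nonneg.2 hκ0.le)), hderiv]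
    have h1 : h x ^ 2 ≤ h x * N x := by
      rw [sq]
      exact mul_le_mul_of_nonneg_left (hhN x) (hh0 x)
    have h2 : stdNormalCDF x ≤ stdNormalCDF d := monotone_stdNormalCDF hx.le
    calc (1 - stdNormalCDF d) * κ⁻¹ * h x ^ 2
        ≤ (1 - stdNormalCDF x) * κ⁻¹ * (h x * N x) := by
          have h3 := mul_nonneg (sub_nonneg.2 (stdNormalCDF_le_one x)) (inv_nonneg.2 hκ0.le)
          gcongr
      _ = (1 - stdNormalCDF x) * (κ⁻¹ * h x) * N x := by ring
      _ ≤ _ := by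
        refine mul_le_mul_of_nonneg_right (le_add_of_nonneg_left ?_) (hN0 x)
        exact mul_nonneg (gaussianPDFReal_nonneg 0 1 x) (sub_nonneg.2 (hB1 x))
  have hint : √((1 - stdNormalCDF d) * κ⁻¹) * κ ≤ contFidelity (deriv A) N := by
    rw [hκ, ← integral_const_mul]
    exact integral_mono (hhi.const_mul _) (integrable_sqrt_mul hA'0 hN0 hAi hNi) hpt
  calc (1 - stdNormalCDF d) * κ = (√((1 - stdNormalCDF d) * κ⁻¹) * κ) ^ 2 := by
        rw [mul_pow, Real.sq_sqrt (mul_nonneg hΦ1 (inv_nonneg.2 hκ0.le))]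
        field_simp
    _ ≤ _ := by gcongr

end RayleighClass

lemma tendsto_stdNormalCDF_atTop : Tendsto stdNormalCDF atTop (𝓝 1) := tendsto_cdf_atTop _

lemma tendsto_stdNormalCDF_atBot : Tendsto stdNormalCDF atBot (𝓝 0) := tendsto_cdf_atBot _

lemma tendsto_one_sub_rayleighNormal {ι : Type*} {F : Filter ι} {w c : ι → ℝ} {c₀ : ℝ}
    (hw : Tendsto w F atTop) (hc₀ : 0 < c₀) (hc : Tendsto c F (𝓝 c₀)) (s m : ℝ) :
    Tendsto (fun i => 1 - rayleighNormal (c i * w i ^ 4) (s * w i ^ 2) (m * w i ^ 2)) F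
      (𝓝 (stdNormalCDF ((min s 0 - m) / √c₀))) := by
  have hΦ := continuous_stdNormalCDF
  have hinv : Tendsto (fun i => (w i)⁻¹) F (𝓝 0) := hw.inv_tendsto_atTop
  have hev : ∀ᶠ i in F, 0 < w i ∧ 0 < c i :=
    (hw.eventually_gt_atTop 0).and (hc.eventually_const_lt hc₀)
  -- A point `k * w ^ 2 + e * w` is `k + e / w` on the scale `w ^ 2`, so the term `e * w` disappears
  -- in the limit.
  have hsqrt : ∀ i, 0 < w i ∧ 0 < c i → ∀ k : ℝ, ∀ e : ℝ,
      ((k * w i ^ 2 + e * w i) - m * w i ^ 2) / √(c i * w i ^ 4) =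
        (k + e * (w i)⁻¹ - m) / √(c i) := by
    rintro i ⟨h1, h2⟩ k e
    have h3 : √(c i * w i ^ 4) = √(c i) * w i ^ 2 := by
      rw [Real.sqrt_mul h2.le, show w i ^ 4 = (w i ^ 2) ^ 2 by ring, Real.sqrt_sq (by positivity)]
    have h4 := (Real.sqrt_pos.2 h2).ne'
    rw [h3]
    field_simp
  have hlim : ∀ k e : ℝ, Tendsto (fun i => stdNormalCDF ((k + e * (w i)⁻¹ - m) / √(c i))) F
      (𝓝 (stdNormalCDF ((k - m) / √c₀))) := by
    intro k e
    refine (hΦ.tendsto _).comp (Tendsto.div ?_ hc.sqrt (Real.sqrt_pos.2 hc₀).ne')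
    simpa using ((hinv.const_mul e).const_add k).sub_const m
  -- The cutoff runs from `a = min s 0 * w ^ 2 - 2 * w` to `d = a + w`. The shift by `w` forces `d →
  -- -∞`, hence `Φ(d) → 0`, even when `min s 0 = 0`.
  have hlow : Tendsto (fun i => (1 - stdNormalCDF (min s 0 * w i ^ 2 + (-1) * w i)) *
      stdNormalCDF ((min s 0 + (-2) * (w i)⁻¹ - m) / √(c i))) F
      (𝓝 (stdNormalCDF ((min s 0 - m) / √c₀))) := by
    have hbot : Tendsto (fun i => min s 0 * w i ^ 2 + (-1) * w i) F atBot := by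
      refine tendsto_atBot_mono (fun i => ?_) (tendsto_neg_atTop_atBot.comp hw)
      have := mul_nonpos_of_nonpos_of_nonneg (min_le_right s 0) (sq_nonneg (w i))
      simp only [Function.comp]
      linarith
    simpa using ((tendsto_stdNormalCDF_atBot.comp hbot).const_sub 1).mul (hlim (min s 0) (-2))
  have hle : ∀ᶠ i in F, (1 - stdNormalCDF (min s 0 * w i ^ 2 + (-1) * w i)) *
      stdNormalCDF ((min s 0 + (-2) * (w i)⁻¹ - m) / √(c i)) ≤
      1 - rayleighNormal (c i * w i ^ 4) (s * w i ^ 2) (m * w i ^ 2) := by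
    filter_upwards [hev] with i hi
    rw [← hsqrt i hi]
    obtain ⟨h1, h2⟩ := hi
    refine mul_stdNormalCDF_le_one_sub_rayleighNormal (by positivity) (by linarith) ?_
    have := mul_le_mul_of_nonneg_right (min_le_left s 0) (sq_nonneg (w i))
    linarith
  rcases lt_or_ge s 0 with hs | hs
  · refine tendsto_of_tendsto_of_tendsto_of_le_of_le' hlow (hlim (min s 0) 0) hle ?_
    filter_upwards [hev] with i hi
    rw [← hsqrt i hi, min_eq_left hs.le, zero_mul, add_zero]
    obtain ⟨h1, h2⟩ := hi
    exact one_sub_rayleighNormal_le _ _ (by positivity)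
  -- For `s ≥ 0` the binding constraint is `A ≥ Φ`; splitting at `d = w` makes `1 - Φ(d)` vanish and
  -- is negligible against `w ^ 2`.
  · have hupp : Tendsto (fun i => (√(stdNormalCDF ((min s 0 + 1 * (w i)⁻¹ - m) / √(c i))) +
        √(1 - stdNormalCDF (w i))) ^ 2) F (𝓝 (stdNormalCDF ((min s 0 - m) / √c₀))) := by
      have h := ((hlim (min s 0) 1).sqrt.add
        ((tendsto_stdNormalCDF_atTop.comp hw).const_sub 1).sqrt).pow 2
      rw [sub_self, Real.sqrt_zero, add_zero, Real.sq_sqrt (stdNormalCDF_nonneg _)] at h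
      exact h
    refine tendsto_of_tendsto_of_tendsto_of_le_of_le' hlow hupp hle ?_
    filter_upwards [hev] with i hi
    rw [← hsqrt i hi, min_eq_right hs, zero_mul, zero_add, one_mul]
    obtain ⟨h1, h2⟩ := hi
    exact one_sub_rayleighNormal_le_of_point _ _ _ (by positivity)

/-! ### Distributions close to the uniform one -/

section NearUniform

variable {X : Type*} [Fintype X]

lemma continuous_probDist_apply (x : X) : Continuous fun P : ProbDist X => P x :=
  (continuous_apply x).comp continuous_subtype_val

variable [Nonempty X]

lemma uniformDist_apply (x : X) : uniformDist X x = (Fintype.card X : ℝ)⁻¹ :=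
  stdSimplex.barycenter_apply x

lemma uniformDist_pos (x : X) : 0 < uniformDist X x := by
  rw [uniformDist_apply]
  exact inv_pos.2 (by exact_mod_cast Fintype.card_pos)

lemma continuousAt_logb_apply (x : X) :
    ContinuousAt (fun P : ProbDist X => Real.logb 2 (P x)) (uniformDist X) :=
  (Real.continuousAt_logb (uniformDist_pos x).ne').comp
    (f := fun P : ProbDist X => P x) (continuous_probDist_apply x).continuousAt

lemma continuousAt_shannonEntropy : ContinuousAt (shannonEntropy (X := X)) (uniformDist X) :=
  tendsto_finsetSum _ fun x _ =>
    (continuous_probDist_apply x).continuousAt.mul (continuousAt_logb_apply x).neg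

lemma infoVariance_uniformDist : infoVariance (uniformDist X) = 0 := by
  refine Finset.sum_eq_zero fun x _ => ?_
  rw [shannonEntropy_uniformDist, uniformDist_apply, Real.logb_inv, neg_neg, sub_self]
  simp

lemma continuousAt_infoVariance : ContinuousAt (infoVariance (X := X)) (uniformDist X) :=
  tendsto_finsetSum _ fun x _ => (continuous_probDist_apply x).continuousAt.mul
    (((continuousAt_logb_apply x).neg.sub continuousAt_shannonEntropy).pow 2)

/-- Zero variance means uniform on the support, and close to `U_l` the support is the whole
alphabet. -/
lemma eventually_infoVariance_pos : ∀ᶠ P in 𝓝[≠] uniformDist X, 0 < infoVariance P := by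
  have hpos : ∀ᶠ P in 𝓝 (uniformDist X), ∀ x, 0 < P x := eventually_all.2 fun x =>
    (continuous_probDist_apply x).continuousAt.eventually_const_lt (uniformDist_pos x)
  filter_upwards [hpos.filter_mono nhdsWithin_le_nhds, self_mem_nhdsWithin] with P hP hne
  refine (infoVariance_nonneg P).lt_of_ne fun h => hne ?_
  have hc : ∀ x, P x = 2 ^ (-shannonEntropy P) := fun x =>
    (exists_eq_of_infoVariance_eq_zero h.symm x).resolve_left (hP x).ne'
  have hsum : ∑ x, P x = 1 := P.2.2
  simp_rw [hc] at hsum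
  rw [Finset.sum_const, nsmul_eq_mul, Finset.card_univ] at hsum
  refine stdSimplex.ext (funext fun x => ?_)
  rw [hc, uniformDist_apply]
  exact eq_inv_of_mul_eq_one_right hsum

end NearUniform

theorem tendsto_rayleighNormal_uniform {X Y : Type*} [Fintype X] [Nontrivial X] [Fintype Y]
    {Q : ProbDist Y} (hQ : ¬ IsUniformDist Q) (s t : ℝ) :
    Tendsto (fun P : ProbDist X =>
        √(1 - rayleighNormal (coeffC P Q) (s / √(infoVariance P)) (t * coeffD P Q)))
      (𝓝[≠] (uniformDist X))
      (𝓝 √(stdNormalCDF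
        (√(shannonEntropy Q / (infoVariance Q * Real.logb 2 (Fintype.card X))) *
          (min s 0 - shannonEntropy Q * t)))) := by
  have hl := logb_card_pos X
  have hH := shannonEntropy_pos hQ
  have hV := infoVariance_pos hQ
  have hVlim : Tendsto (fun P : ProbDist X => √√(infoVariance P)) (𝓝[≠] uniformDist X)
      (𝓝[>] 0) := by
    refine tendsto_nhdsWithin_iff.2 ⟨?_, ?_⟩
    · have := (continuousAt_infoVariance (X := X)).sqrt.sqrt.tendsto.mono_left
        (nhdsWithin_le_nhds (s := {uniformDist X}ᶜ))
      simpa [infoVariance_uniformDist] using this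
    · filter_upwards [eventually_infoVariance_pos (X := X)] with P hP
      exact Real.sqrt_pos.2 (Real.sqrt_pos.2 hP)
  -- The scale is `w = V(P) ^ (-1/4)`, so that `w ^ 2 = 1 / √V(P)` and `coeffC P Q` is `w ^ 4` times
  -- a convergent factor.
  have hw : Tendsto (fun P : ProbDist X => (√√(infoVariance P))⁻¹) (𝓝[≠] uniformDist X) atTop :=
    tendsto_inv_nhdsGT_zero.comp hVlim
  have hc : Tendsto (fun P : ProbDist X =>
      shannonEntropy P * (shannonEntropy Q / infoVariance Q)⁻¹) (𝓝[≠] uniformDist X)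
      (𝓝 (Real.logb 2 (Fintype.card X) * (shannonEntropy Q / infoVariance Q)⁻¹)) := by
    rw [← shannonEntropy_uniformDist]
    exact ((continuousAt_shannonEntropy (X := X)).tendsto.mono_left nhdsWithin_le_nhds).mul_const _
  have key := (tendsto_one_sub_rayleighNormal hw (mul_pos hl (inv_pos.2 (div_pos hH hV))) hc s
    (shannonEntropy Q * t)).sqrt
  have harg : √(shannonEntropy Q / (infoVariance Q * Real.logb 2 (Fintype.card X))) *
      (min s 0 - shannonEntropy Q * t) = (min s 0 - shannonEntropy Q * t) /
        √(Real.logb 2 (Fintype.card X) * (shannonEntropy Q / infoVariance Q)⁻¹) := by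
    rw [div_eq_inv_mul (min s 0 - _), ← Real.sqrt_inv]
    congr 2
    field_simp
  rw [harg]
  refine key.congr' ?_
  filter_upwards [eventually_infoVariance_pos (X := X)] with P hP
  have h2 : (√√(infoVariance P))⁻¹ ^ 2 = (√(infoVariance P))⁻¹ := by
    rw [inv_pow, Real.sq_sqrt (Real.sqrt_nonneg _)]
  have h4 : (√√(infoVariance P))⁻¹ ^ 4 = (infoVariance P)⁻¹ := by
    rw [show (√√(infoVariance P))⁻¹ ^ 4 = ((√√(infoVariance P))⁻¹ ^ 2) ^ 2 by ring, h2, inv_pow,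
      Real.sq_sqrt hP.le]
  rw [h2, h4]
  congr 3
  · rw [coeffC]
    ring
  · rw [coeffD]
    ring

theorem admissibleFidelity_uniformDist {X Y : Type*} [Fintype X] [Nontrivial X] [Fintype Y]
    {Q : ProbDist Y} (hQ : ¬ IsUniformDist Q) (i : Conversion) (s t : ℝ) :
    admissibleFidelity i (uniformDist X) Q s t =
      √(stdNormalCDF
        (√(shannonEntropy Q / (infoVariance Q * Real.logb 2 (Fintype.card X))) *
          (min s 0 - shannonEntropy Q * t))) := by
  rw [admissibleFidelity, secondOrderFidelity, shannonEntropy_uniformDist]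
  exact (tendsto_maxFidelity_uniform hQ i (by simp) (by simp)).liminf_eq

end

theorem mainTheorem6 {X Y : Type*} [Fintype X] [Nontrivial X] [Fintype Y]
    (Q : ProbDist Y) (hQ : ¬ IsUniformDist Q) (s₂ t₂ : ℝ) :
    (∀ i : Conversion,
      admissibleFidelity i (uniformDist X) Q s₂ t₂ =
        √(stdNormalCDF
          (√(shannonEntropy Q / (infoVariance Q * Real.logb 2 (Fintype.card X))) *
            (min s₂ 0 - shannonEntropy Q * t₂)))) ∧
    (∀ (i : Conversion) (S T : ℕ → ℝ),
      (fun n : ℕ => S n - (Real.logb 2 (Fintype.card X) * n + s₂ * √n))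
        =o[atTop] (fun n : ℕ => √(n : ℝ)) →
      (fun n : ℕ => T n - (Real.logb 2 (Fintype.card X) / shannonEntropy Q * n + t₂ * √n))
        =o[atTop] (fun n : ℕ => √(n : ℝ)) →
      liminfFidelity i (uniformDist X) Q S T =
        admissibleFidelity i (uniformDist X) Q s₂ t₂) ∧
    (∀ i : Conversion,
      Tendsto
        (fun P : ProbDist X =>
          √(1 - rayleighNormal (coeffC P Q) (s₂ / √(infoVariance P)) (t₂ * coeffD P Q)))
        (𝓝[≠] (uniformDist X)) (𝓝 (admissibleFidelity i (uniformDist X) Q s₂ t₂))) := by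
  refine ⟨fun i => admissibleFidelity_uniformDist hQ i s₂ t₂, fun i S T hS hT => ?_, fun i => ?_⟩
  · rw [admissibleFidelity_uniformDist hQ]
    exact (tendsto_maxFidelity_uniform hQ i hS hT).liminf_eq
  · rw [admissibleFidelity_uniformDist hQ]
    exact tendsto_rayleighNormal_uniform hQ s₂ t₂
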